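/- Let $p$ be a prime, let $G$ be a finite $p$-group, and let $\mathcal C$ be a set of subgroups of $G$ (the cells) with union $G$, each of which is either a maximal cyclic subgroup of $G$ (a maximal element among the cyclic subgroups) or elementary abelian of order $p^2$. Let $R_{\mathcal C}(G)$ be the set of all maps $f\colon G\to G$ such that $f|_C\in\operatorname{End}(C)$ for every $C\in\mathcal C$; it is a ring under $(f+g)(x)=f(x)g(x)$ and $(fg)(x)=f(g(x))$. Write $\mathbb Z_k=\mathbb Z/k\mathbb Z$. For integers $m>0$, $n\ge 0$ and indices $i_1,\dots,i_n\in\{1,\dots,m\}$, let $N^{m+n}_{i_1,\dots,i_n}$ be the ring of all matrices $$X(\lambda,\nu,\mu)=\begin{pmatrix}\lambda I_m & J(\nu_1,\dots,\nu_n)\\ 0& D(\mu_1,\dots,\mu_n)\end{pmatrix},\qquad \lambda,\nu_1,\dots,\nu_n,\mu_1,\dots,\mu_n\in\mathbb Z_p,$$ where $D(\mu_1,\dots,\mu_n)$ is the diagonal matrix with diagonal entries $\mu_1,\dots,\mu_n$ and $J(\nu_1,\dots,\nu_n)$ is the $m\times n$ matrix with entry $\nu_j$ at position $(i_j,j)$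 for $1\le j\le n$ and zeros elsewhere. For a subgroup $K\le G$ of order $p$, let $M_1,\dots,M_\phi$ be the maximal cyclic subgroups of $G$ containing $K$, with $|M_k|=p^{n_k}$. For $\lambda\in\mathbb Z_p$ let $R_{\Lambda(K),\lambda}$ be the set of tuples $(\lambda_1,\dots,\lambda_\phi)\in\prod_k\mathbb Z_{p^{n_k}}$ such that $z^{\lambda_k}=z^{\lambda_l}$ for all $k,l$ and all $z\in M_k\cap M_l$, and $z^{\lambda_k}=z^{\lambda}$ for all $k$ and all $z\in K$. Then $R_{\Lambda(K)}=\bigcup_{\lambda\in\mathbb Z_p}R_{\Lambda(K),\lambda}$ is a subring of $\prod_k\mathbb Z_{p^{n_k}}$. Given $m,n,i_1,\dots,i_n$ as above and distinct subgroups $K_1,\dots,K_m$ of $G$ of order $p$, let $$S=\bigl\{(X(\lambda,\nu,\mu),\mathbf x_1,\dots,\mathbf x_m)\;:\;\lambda\in\mathbb Z_p,\ \nu,\mu\in\mathbb Z_p^n,\ \mathbf x_a\in R_{\Lambda(K_a),\lambda}\text{ for }1\le a\le m\bigr\},$$ a subring (a subdirect product) of $N^{m+n}_{i_1,\dots,i_n}\times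 R_{\Lambda(K_1)}\times\dots\times R_{\Lambda(K_m)}$. **Theorem.** The ring $R_{\mathcal C}(G)$ is isomorphic to a direct product of finitely many (possibly zero) rings, each of which is either $M_2(\mathbb Z_p)$ or a ring $S$ as above, for some $m>0$, $n\ge0$, $i_1,\dots,i_n\in\{1,\dots,m\}$ and distinct subgroups $K_1,\dots,K_m$ of $G$ of order $p$ (all of which may vary with the factor). -/

import Mathlib

/-! ### Coverings and the ring of a covering -/

/-- A covering of `G` by abelian subgroups. -/
structure AbelianCover (G : Type*) [Group G] where
  cells : Set (Subgroup G)
  covers : ∀ x : G, ∃ C ∈ cells, x ∈ C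
  comm : ∀ C ∈ cells, ∀ x ∈ C, ∀ y ∈ C, x * y = y * x

/-- `M` is maximal among the cyclic subgroups of `G`. -/
def IsMaximalCyclic {G : Type*} [Group G] (M : Subgroup G) : Prop :=
  Maximal (fun H : Subgroup G => IsCyclic H) M

/-- `C` is elementary abelian of order `p ^ 2`. -/
def IsElemAbelianSq (p : ℕ) {G : Type*} [Group G] (C : Subgroup G) : Prop :=
  Nat.card C = p ^ 2 ∧ (∀ x ∈ C, x ^ p = 1) ∧ ∀ x ∈ C, ∀ y ∈ C, x * y = y * x

namespace AbelianCover

variable {G : Type*} [Group G]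

/-- Every cell is a maximal cyclic subgroup of `G` or elementary abelian of order `p ^ 2`. -/
def IsStar (p : ℕ) (𝒞 : AbelianCover G) : Prop :=
  ∀ C ∈ 𝒞.cells, IsMaximalCyclic C ∨ IsElemAbelianSq p C

/-- The self-maps of `G` that restrict to an endomorphism of every cell. -/
def FunRing (𝒞 : AbelianCover G) : Type _ :=
  {f : G → G // ∀ C ∈ 𝒞.cells,
    (∀ x ∈ C, f x ∈ C) ∧ ∀ x ∈ C, ∀ y ∈ C, f (x * y) = f x * f y}

namespace FunRing

variable {𝒞 : AbelianCover G}

instance : CoeFun 𝒞.FunRing (fun _ => G → G) := ⟨Subtype.val⟩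

@[ext] theorem ext {f g : 𝒞.FunRing} (h : ∀ x, f x = g x) : f = g :=
  Subtype.ext (funext h)

theorem map_mem (f : 𝒞.FunRing) {C : Subgroup G} (hC : C ∈ 𝒞.cells) {x : G} (hx : x ∈ C) :
    f x ∈ C := (f.2 C hC).1 x hx

theorem map_mul' (f : 𝒞.FunRing) {C : Subgroup G} (hC : C ∈ 𝒞.cells) {x y : G}
    (hx : x ∈ C) (hy : y ∈ C) : f (x * y) = f x * f y := (f.2 C hC).2 x hx y hy

theorem map_one' (f : 𝒞.FunRing) : f 1 = 1 := by
  obtain ⟨C, hC, h1⟩ := 𝒞.covers 1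
  have h := f.map_mul' hC h1 h1
  rw [mul_one] at h
  exact left_eq_mul.mp h

/-- Sum: the pointwise product in `G`. -/
instance : Add 𝒞.FunRing := ⟨fun f g => ⟨fun x => f x * g x, fun C hC =>
  ⟨fun _ hx => C.mul_mem (f.map_mem hC hx) (g.map_mem hC hx), fun x hx y hy => by
    have h := 𝒞.comm C hC _ (f.map_mem hC hy) _ (g.map_mem hC hx)
    simp only [f.map_mul' hC hx hy, g.map_mul' hC hx hy]
    rw [mul_assoc, ← mul_assoc (f y), h]
    simp only [mul_assoc]⟩⟩⟩

instance : Zero 𝒞.FunRing := ⟨⟨fun _ => 1, fun C _ => ⟨fun _ _ => C.one_mem, by simp⟩⟩⟩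

instance : Neg 𝒞.FunRing := ⟨fun f => ⟨fun x => (f x)⁻¹, fun C hC =>
  ⟨fun _ hx => C.inv_mem (f.map_mem hC hx), fun x hx y hy => by
    simp only [f.map_mul' hC hx hy]
    rw [𝒞.comm C hC _ (f.map_mem hC hx) _ (f.map_mem hC hy), mul_inv_rev]⟩⟩⟩

/-- Product: composition. -/
instance : Mul 𝒞.FunRing := ⟨fun f g => ⟨fun x => f (g x), fun _ hC =>
  ⟨fun _ hx => f.map_mem hC (g.map_mem hC hx), fun x hx y hy => by
    simp only [g.map_mul' hC hx hy]
    exact f.map_mul' hC (g.map_mem hC hx) (g.map_mem hC hy)⟩⟩⟩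

instance : One 𝒞.FunRing := ⟨⟨fun x => x, fun _ _ => ⟨fun _ hx => hx, fun _ _ _ _ => rfl⟩⟩⟩

theorem add_apply (f g : 𝒞.FunRing) (x : G) : (f + g) x = f x * g x := rfl
theorem zero_apply (x : G) : (0 : 𝒞.FunRing) x = 1 := rfl
theorem neg_apply (f : 𝒞.FunRing) (x : G) : (-f) x = (f x)⁻¹ := rfl
theorem mul_apply (f g : 𝒞.FunRing) (x : G) : (f * g) x = f (g x) := rfl
theorem one_apply (x : G) : (1 : 𝒞.FunRing) x = x := rfl

instance : Ring 𝒞.FunRing where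
  add_assoc f g h := by ext x; simp only [add_apply, mul_assoc]
  zero_add f := by ext x; simp only [add_apply, zero_apply, one_mul]
  add_zero f := by ext x; simp only [add_apply, zero_apply, mul_one]
  add_comm f g := by
    ext x
    obtain ⟨C, hC, hx⟩ := 𝒞.covers x
    exact 𝒞.comm C hC _ (f.map_mem hC hx) _ (g.map_mem hC hx)
  neg_add_cancel f := by ext x; simp only [add_apply, neg_apply, zero_apply, inv_mul_cancel]
  mul_assoc f g h := rfl
  one_mul f := rfl
  mul_one f := rfl
  zero_mul f := rfl
  mul_zero f := by ext x; simp only [mul_apply, zero_apply, map_one']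
  left_distrib f g h := by
    ext x
    obtain ⟨C, hC, hx⟩ := 𝒞.covers x
    exact f.map_mul' hC (g.map_mem hC hx) (h.map_mem hC hx)
  right_distrib f g h := rfl
  nsmul := nsmulRec
  zsmul := zsmulRec

end FunRing

end AbelianCover

/-! ### The block upper triangular matrix rings -/

/-- The block matrix with upper left block `l • 1`, upper right block the `m × n` matrix whose
`j`-th column has the entry `ν j` in row `i j` and zeros elsewhere, lower left block `0`, and lower
right block the diagonal matrix of `μ`. -/
def blockMatrix {R : Type*} [CommRing R] {m n : ℕ} (i : Fin n → Fin m) (l : R) (ν μ : Fin n → R) :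
    Matrix (Fin m ⊕ Fin n) (Fin m ⊕ Fin n) R :=
  Matrix.fromBlocks (l • 1) (Matrix.of fun a j => if a = i j then ν j else 0) 0
    (Matrix.diagonal μ)

section blockMatrix

variable {R : Type*} [CommRing R] {m n : ℕ} (i : Fin n → Fin m)

theorem blockMatrix_one : blockMatrix i (1 : R) 0 1 = 1 := by
  ext (a | a) (b | b) <;>
    simp [blockMatrix, Matrix.one_apply]

theorem blockMatrix_zero : blockMatrix i (0 : R) 0 0 = 0 := by
  ext (a | a) (b | b) <;> simp [blockMatrix]

theorem blockMatrix_add (l l' : R) (ν ν' μ μ' : Fin n → R) :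
    blockMatrix i l ν μ + blockMatrix i l' ν' μ' = blockMatrix i (l + l') (ν + ν') (μ + μ') := by
  ext (a | a) (b | b)
  · simp [blockMatrix, add_mul]
  · by_cases h : a = i b <;> simp [blockMatrix, h]
  · simp [blockMatrix]
  · by_cases h : a = b <;> simp [blockMatrix, h]

theorem blockMatrix_neg (l : R) (ν μ : Fin n → R) :
    -blockMatrix i l ν μ = blockMatrix i (-l) (-ν) (-μ) := by
  rw [neg_eq_iff_add_eq_zero, blockMatrix_add]
  simpa using blockMatrix_zero i

theorem blockMatrix_mul (l l' : R) (ν ν' μ μ' : Fin n → R) :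
    blockMatrix i l ν μ * blockMatrix i l' ν' μ' =
      blockMatrix i (l * l') (fun j => l * ν' j + ν j * μ' j) (μ * μ') := by
  rw [blockMatrix, blockMatrix, Matrix.fromBlocks_multiply, blockMatrix]
  congr 1
  · simp [smul_smul, mul_comm]
  · ext a b
    by_cases h : a = i b <;> simp [Matrix.mul_diagonal, h]
  · simp
  · simp

/-- The ring of all matrices `blockMatrix i l ν μ`, for a fixed `i`. -/
def blockMatrixRing (R : Type*) [CommRing R] {m n : ℕ} (i : Fin n → Fin m) :
    Subring (Matrix (Fin m ⊕ Fin n) (Fin m ⊕ Fin n) R) where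
  carrier := {A | ∃ (l : R) (ν μ : Fin n → R), A = blockMatrix i l ν μ}
  mul_mem' := by
    rintro _ _ ⟨l, ν, μ, rfl⟩ ⟨l', ν', μ', rfl⟩
    exact ⟨_, _, _, blockMatrix_mul i _ _ _ _ _ _⟩
  one_mem' := ⟨_, _, _, (blockMatrix_one i).symm⟩
  add_mem' := by
    rintro _ _ ⟨l, ν, μ, rfl⟩ ⟨l', ν', μ', rfl⟩
    exact ⟨_, _, _, blockMatrix_add i _ _ _ _ _ _⟩
  zero_mem' := ⟨_, _, _, (blockMatrix_zero i).symm⟩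
  neg_mem' := by
    rintro _ ⟨l, ν, μ, rfl⟩
    exact ⟨_, _, _, blockMatrix_neg i _ _ _⟩

end blockMatrix

/-! ### The rings of compatible tuples -/

/-- The subgroups of `G` of order `p`. -/
abbrev OrderSubgroup (p : ℕ) (G : Type*) [Group G] : Type _ :=
  {K : Subgroup G // Nat.card K = p}

/-- The maximal cyclic subgroups of `G` that contain `K`. -/
abbrev MaxCyclicAbove {G : Type*} [Group G] (K : Subgroup G) : Type _ :=
  {M : Subgroup G // IsMaximalCyclic M ∧ K ≤ M}

section pow

variable {G : Type*} [Group G] {n : ℕ} {z : G}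

theorem pow_val_add [NeZero n] (hz : z ^ n = 1) (a b : ZMod n) :
    z ^ (a + b).val = z ^ a.val * z ^ b.val := by
  rw [ZMod.val_add, ← pow_add, ← pow_mod_orderOf, Nat.mod_mod_of_dvd _ (orderOf_dvd_of_pow_eq_one hz),
    pow_mod_orderOf]

theorem pow_val_mul (hz : z ^ n = 1) (a b : ZMod n) :
    z ^ (a * b).val = (z ^ a.val) ^ b.val := by
  rw [ZMod.val_mul, ← pow_mul, ← pow_mod_orderOf, Nat.mod_mod_of_dvd _ (orderOf_dvd_of_pow_eq_one hz),
    pow_mod_orderOf]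

theorem pow_val_one (hz : z ^ n = 1) : z ^ (1 : ZMod n).val = z := by
  rw [ZMod.val_one_eq_one_mod, ← pow_mod_orderOf,
    Nat.mod_mod_of_dvd _ (orderOf_dvd_of_pow_eq_one hz), pow_mod_orderOf, pow_one]

theorem pow_val_neg [NeZero n] (hz : z ^ n = 1) (a : ZMod n) : z ^ (-a).val = (z ^ a.val)⁻¹ := by
  rw [eq_inv_iff_mul_eq_one, ← pow_val_add hz]
  simp

end pow

section tuples

variable {p : ℕ} {G : Type*} [Group G]

/-- The tuples `x`, with one entry `x M` in `ℤ / |M|` for every maximal cyclic subgroup `M`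
containing `K`, such that the endomorphisms `z ↦ z ^ x M` of the subgroups `M` agree wherever two
of them are defined, and restrict on `K` to the endomorphism `z ↦ z ^ l`. -/
def tupleSet (K : OrderSubgroup p G) (l : ZMod p) :
    Set (∀ M : MaxCyclicAbove K.1, ZMod (Nat.card M.1)) :=
  {x | (∀ M M' : MaxCyclicAbove K.1, ∀ z ∈ M.1, z ∈ M'.1 → z ^ (x M).val = z ^ (x M').val) ∧
    ∀ M : MaxCyclicAbove K.1, ∀ z ∈ K.1, z ^ (x M).val = z ^ l.val}

theorem pow_card_of_mem {H : Subgroup G} {z : G} (hz : z ∈ H) : z ^ Nat.card H = 1 := by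
  have h := pow_card_eq_one' (x := (⟨z, hz⟩ : H))
  exact congrArg Subtype.val h

theorem OrderSubgroup.pow_of_mem (K : OrderSubgroup p G) {z : G} (hz : z ∈ K.1) : z ^ p = 1 := by
  have h := pow_card_of_mem hz
  rwa [K.2] at h

variable {K : OrderSubgroup p G} {l l' : ZMod p}
  {x y : ∀ M : MaxCyclicAbove K.1, ZMod (Nat.card M.1)}

theorem tupleSet_one : (1 : ∀ M : MaxCyclicAbove K.1, ZMod (Nat.card M.1)) ∈ tupleSet K 1 := by
  refine ⟨fun M M' z hz hz' => ?_, fun M z hz => ?_⟩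
  · simp only [Pi.one_apply]
    rw [pow_val_one (pow_card_of_mem hz), pow_val_one (pow_card_of_mem hz')]
  · simp only [Pi.one_apply]
    rw [pow_val_one (pow_card_of_mem (M.2.2 hz)), pow_val_one (K.pow_of_mem hz)]

theorem tupleSet_zero : (0 : ∀ M : MaxCyclicAbove K.1, ZMod (Nat.card M.1)) ∈ tupleSet K 0 := by
  refine ⟨fun M M' z hz hz' => ?_, fun M z hz => ?_⟩ <;> simp

theorem tupleSet_add [NeZero p] [Finite G] (hx : x ∈ tupleSet K l) (hy : y ∈ tupleSet K l') :
    x + y ∈ tupleSet K (l + l') := by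
  refine ⟨fun M M' z hz hz' => ?_, fun M z hz => ?_⟩
  · simp only [Pi.add_apply]
    rw [pow_val_add (pow_card_of_mem hz), pow_val_add (pow_card_of_mem hz'),
      hx.1 M M' z hz hz', hy.1 M M' z hz hz']
  · simp only [Pi.add_apply]
    rw [pow_val_add (pow_card_of_mem (M.2.2 hz)), pow_val_add (K.pow_of_mem hz),
      hx.2 M z hz, hy.2 M z hz]

theorem tupleSet_mul (hx : x ∈ tupleSet K l) (hy : y ∈ tupleSet K l') :
    x * y ∈ tupleSet K (l * l') := by
  refine ⟨fun M M' z hz hz' => ?_, fun M z hz => ?_⟩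
  · simp only [Pi.mul_apply]
    rw [pow_val_mul (pow_card_of_mem hz), pow_val_mul (pow_card_of_mem hz'),
      hx.1 M M' z hz hz']
    refine hy.1 M M' _ ?_ (M'.1.pow_mem hz' _)
    rw [← hx.1 M M' z hz hz']
    exact M.1.pow_mem hz _
  · simp only [Pi.mul_apply]
    rw [pow_val_mul (pow_card_of_mem (M.2.2 hz)), pow_val_mul (K.pow_of_mem hz),
      hx.2 M z hz]
    exact hy.2 M _ (K.1.pow_mem hz _)

theorem tupleSet_neg [NeZero p] [Finite G] (hx : x ∈ tupleSet K l) : -x ∈ tupleSet K (-l) := by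
  refine ⟨fun M M' z hz hz' => ?_, fun M z hz => ?_⟩
  · simp only [Pi.neg_apply]
    rw [pow_val_neg (pow_card_of_mem hz), pow_val_neg (pow_card_of_mem hz'),
      hx.1 M M' z hz hz']
  · simp only [Pi.neg_apply]
    rw [pow_val_neg (pow_card_of_mem (M.2.2 hz)), pow_val_neg (K.pow_of_mem hz),
      hx.2 M z hz]

/-- The ring of compatible tuples of `K`: the union of the sets `tupleSet K l`. -/
def tupleRing [NeZero p] [Finite G] (K : OrderSubgroup p G) :
    Subring (∀ M : MaxCyclicAbove K.1, ZMod (Nat.card M.1)) where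
  carrier := {x | ∃ l : ZMod p, x ∈ tupleSet K l}
  mul_mem' := fun ⟨_, hx⟩ ⟨_, hy⟩ => ⟨_, tupleSet_mul hx hy⟩
  one_mem' := ⟨_, tupleSet_one⟩
  add_mem' := fun ⟨_, hx⟩ ⟨_, hy⟩ => ⟨_, tupleSet_add hx hy⟩
  zero_mem' := ⟨_, tupleSet_zero⟩
  neg_mem' := fun ⟨_, hx⟩ => ⟨_, tupleSet_neg hx⟩

end tuples

/-! ### The subdirect products -/

/-- The data that determine one of the subdirect products: sizes `m > 0` and `n`, the row indices
`i 1, …, i n` in `{1, …, m}`, and distinct subgroups `K 1, …, K m` of order `p`. -/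
structure SubdirectData (p : ℕ) (G : Type*) [Group G] where
  m : ℕ
  n : ℕ
  m_pos : 0 < m
  i : Fin n → Fin m
  K : Fin m ↪ OrderSubgroup p G

namespace SubdirectData

variable {p : ℕ} [NeZero p] {G : Type*} [Group G] [Finite G]

/-- The pairs of a matrix `blockMatrix i l ν μ` and a vector of tuples `(x 1, …, x m)` with
`x a ∈ tupleSet (K a) l`. (The one-entry tuples attached to the diagonal entries `μ j` carry
nothing that is not in the matrix.) -/
def ring (D : SubdirectData p G) :
    Subring (blockMatrixRing (ZMod p) D.i × ∀ a : Fin D.m, tupleRing (D.K a)) where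
  carrier := {P | ∃ (l : ZMod p) (ν μ : Fin D.n → ZMod p),
    P.1.1 = blockMatrix D.i l ν μ ∧ ∀ a, (P.2 a).1 ∈ tupleSet (D.K a) l}
  mul_mem' := by
    rintro P Q ⟨l, ν, μ, h, hx⟩ ⟨l', ν', μ', h', hx'⟩
    refine ⟨_, _, _, Eq.trans ?_ (blockMatrix_mul D.i l l' ν ν' μ μ'), fun a => tupleSet_mul (hx a) (hx' a)⟩
    rw [← h, ← h']
    rfl
  one_mem' := ⟨_, _, _, (blockMatrix_one D.i).symm, fun _ => tupleSet_one⟩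
  add_mem' := by
    rintro P Q ⟨l, ν, μ, h, hx⟩ ⟨l', ν', μ', h', hx'⟩
    refine ⟨_, _, _, Eq.trans ?_ (blockMatrix_add D.i l l' ν ν' μ μ'), fun a => tupleSet_add (hx a) (hx' a)⟩
    rw [← h, ← h']
    rfl
  zero_mem' := ⟨_, _, _, (blockMatrix_zero D.i).symm, fun _ => tupleSet_zero⟩
  neg_mem' := by
    rintro P ⟨l, ν, μ, h, hx⟩
    refine ⟨_, _, _, Eq.trans ?_ (blockMatrix_neg D.i l ν μ), fun a => tupleSet_neg (hx a)⟩
    rw [← h]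
    rfl

end SubdirectData

/-! ### Powers and subgroups of prime order -/

/-! An element of the ring is determined by its restrictions to the cells, and endomorphisms of the
cells glue exactly when they agree on intersections. Call a subgroup of order p fixed if it lies in
a cyclic cell or in two different cells. Every element of the ring maps it to itself
(`Fixed.stable`), hence acts on it by a scalar.

In an elementary abelian cell, viewed as a plane over ℤ/p, the fixed subgroups are common eigenlines
of all elements of the ring, and their number decides the shape of the action. With none, the cell
meets the others trivially, every matrix is possible, and a factor M₂(ℤ/p) splits off. With exactly
one, the matrices are upper triangular in an adapted basis: the corner is the scalar of the fixed
subgroup, the second column (ν, μ) is free. With two, the matrix is diagonal and consists of the two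
scalars. With three or more it is a scalar matrix, so the scalars of all fixed subgroups in the cell
coincide (`Linked.scalar_eq`). Cyclic cells contribute compatible exponents, which restrict to the
scalar on the subgroup of order p below them.

So scalars of different fixed subgroups are tied together only through `Linked`, and each class of
the equivalence relation it generates yields one factor S: m counts the fixed subgroups in the
class, n the cells whose unique fixed subgroup is in the class, and the row indices say which
subgroup that is. These data determine the element (`FunRing.eq_of_data`), and all admissible data
occur (`ActionData.exists_funRing`). -/

theorem pow_val_natCast {G : Type*} [Group G] {n : ℕ} {z : G} (hz : z ^ n = 1) (k : ℕ) :
    z ^ (k : ZMod n).val = z ^ k := by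
  rw [ZMod.val_natCast, ← pow_mod_orderOf, Nat.mod_mod_of_dvd _ (orderOf_dvd_of_pow_eq_one hz),
    pow_mod_orderOf]

theorem pow_val_injective {G : Type*} [Group G] {n : ℕ} [NeZero n] {z : G} (hz : orderOf z = n)
    {a b : ZMod n} (h : z ^ a.val = z ^ b.val) : a = b := by
  subst hz
  exact ZMod.val_injective _ (pow_injOn_Iio_orderOf (ZMod.val_lt a) (ZMod.val_lt b) h)

theorem Subgroup.exists_generator {G : Type*} [Group G] {H : Subgroup G} (hH : IsCyclic H) :
    ∃ w ∈ H, H = Subgroup.zpowers w := by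
  obtain ⟨w, hw⟩ := hH.exists_generator
  refine ⟨w, w.2, le_antisymm (fun z hz => ?_) (by simp)⟩
  obtain ⟨k, hk⟩ := Subgroup.mem_zpowers_iff.1 (hw ⟨z, hz⟩)
  exact Subgroup.mem_zpowers_iff.2 ⟨k, congrArg Subtype.val hk⟩

theorem Subgroup.exists_pow_eq {G : Type*} [Group G] [Finite G] {z w : G}
    (h : z ∈ Subgroup.zpowers w) : ∃ k : ℕ, w ^ k = z := by
  rwa [← mem_powers_iff_mem_zpowers] at h

namespace OrderSubgroup

variable {p : ℕ} {G : Type*} [Group G]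

theorem isCyclic [Fact p.Prime] (K : OrderSubgroup p G) : IsCyclic K.1 :=
  isCyclic_of_prime_card K.2

theorem orderOf_of_mem [Fact p.Prime] (K : OrderSubgroup p G) {z : G} (hz : z ∈ K.1)
    (h1 : z ≠ 1) : orderOf z = p :=
  orderOf_eq_prime (K.pow_of_mem hz) h1

theorem eq_zpowers [Fact p.Prime] [Finite G] (K : OrderSubgroup p G) {z : G} (hz : z ∈ K.1)
    (h1 : z ≠ 1) : K.1 = Subgroup.zpowers z := by
  symm
  apply Subgroup.eq_of_le_of_card_ge (by simpa using hz)
  rw [Nat.card_zpowers, K.orderOf_of_mem hz h1, K.2]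

theorem exists_ne_one [Fact p.Prime] (K : OrderSubgroup p G) : ∃ z ∈ K.1, z ≠ 1 := by
  by_contra! h
  have h2 := K.2
  rw [(Subgroup.eq_bot_iff_forall _).2 h, Subgroup.card_bot] at h2
  exact (Fact.out : p.Prime).one_lt.ne h2

theorem le_of_mem [Fact p.Prime] [Finite G] (K : OrderSubgroup p G) {C : Subgroup G} {z : G}
    (hz : z ∈ K.1) (h1 : z ≠ 1) (hC : z ∈ C) : K.1 ≤ C := by
  rw [K.eq_zpowers hz h1]
  simpa using hC

theorem eq_of_mem [Fact p.Prime] [Finite G] {K K' : OrderSubgroup p G} {z : G}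
    (hz : z ∈ K.1) (hz' : z ∈ K'.1) (h1 : z ≠ 1) : K = K' :=
  Subtype.ext ((K.eq_zpowers hz h1).trans (K'.eq_zpowers hz' h1).symm)

/-- The subgroup generated by an element of order `p`. -/
def ofElement [Fact p.Prime] (z : G) (hz : z ^ p = 1) (h1 : z ≠ 1) : OrderSubgroup p G :=
  ⟨Subgroup.zpowers z, by rw [Nat.card_zpowers, orderOf_eq_prime hz h1]⟩

theorem mem_ofElement [Fact p.Prime] {z : G} (hz : z ^ p = 1) (h1 : z ≠ 1) :
    z ∈ (ofElement z hz h1).1 := Subgroup.mem_zpowers z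

/-- Both subgroups fill out the set of solutions of a ^ p = 1 in `M`, since a cyclic group has at
most p of them. -/
theorem eq_of_le_cyclic [Fact p.Prime] [Finite G] {M : Subgroup G} (hM : IsCyclic M)
    {K K' : OrderSubgroup p G} (h : K.1 ≤ M) (h' : K'.1 ≤ M) : K = K' := by
  classical
  have := Fintype.ofFinite M
  have hp := (Fact.out : p.Prime).pos
  have key : ∀ L : OrderSubgroup p G, L.1 ≤ M →
      (L.1.subgroupOf M : Set M) = {a : M | a ^ p = 1} := by
    intro L hL
    apply Set.eq_of_subset_of_ncard_le
    · intro a ha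
      exact Subtype.ext (by simpa using L.pow_of_mem ha)
    · have h1 := IsCyclic.card_pow_eq_one_le (α := M) hp
      have h2 : Nat.card (L.1.subgroupOf M) = p := by
        rw [Nat.card_congr (Subgroup.subgroupOfEquivOfLe hL).toEquiv, L.2]
      rw [← Nat.card_coe_set_eq (L.1.subgroupOf M : Set M)]
      refine le_trans ?_ h2.ge
      rw [Set.ncard_eq_toFinset_card']
      simpa using h1
    · exact Set.toFinite _
  have := (key K h).trans (key K' h').symm
  have h3 := SetLike.coe_injective this
  exact Subtype.ext (Subgroup.subgroupOf_inj.1 h3 |> fun h4 => by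
    rwa [inf_eq_left.2 h, inf_eq_left.2 h'] at h4)

/-- The one place where the p-group hypothesis enters directly: it attaches every nontrivial element
of a cyclic cell to a fixed subgroup. -/
theorem exists_le_zpowers [Fact p.Prime] [Finite G] (hG : IsPGroup p G) {z : G} (h1 : z ≠ 1) :
    ∃ K : OrderSubgroup p G, K.1 ≤ Subgroup.zpowers z := by
  have hp : p.Prime := Fact.out
  obtain ⟨k, hk⟩ := (IsPGroup.iff_orderOf.1 hG) z
  have hk0 : k ≠ 0 := by
    rintro rfl
    exact h1 (orderOf_eq_one_iff.1 (by simpa using hk))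
  have hd : p ∣ orderOf z := hk ▸ dvd_pow_self p hk0
  have ho : orderOf (z ^ (orderOf z / p)) = p := orderOf_pow_orderOf_div (orderOf_pos z).ne' hd
  exact ⟨⟨Subgroup.zpowers (z ^ (orderOf z / p)), by rw [Nat.card_zpowers, ho]⟩,
    by simp⟩

end OrderSubgroup

/-! ### Coordinates on elementary abelian subgroups of order `p ^ 2` -/

/-- Coordinates of an elementary abelian subgroup of rank two. -/
structure Coord (p : ℕ) {G : Type*} [Group G] (E : Subgroup G) where
  toFun : (Fin 2 → ZMod p) → G
  map_add : ∀ u v, toFun (u + v) = toFun u * toFun v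
  inj : Function.Injective toFun
  mem_iff : ∀ z, z ∈ E ↔ ∃ u, toFun u = z

namespace Coord

variable {p : ℕ} {G : Type*} [Group G] {E : Subgroup G}

theorem mem (c : Coord p E) (u : Fin 2 → ZMod p) : c.toFun u ∈ E := (c.mem_iff _).2 ⟨u, rfl⟩

theorem map_zero (c : Coord p E) : c.toFun 0 = 1 := by
  have h := c.map_add 0 0
  rw [add_zero] at h
  exact left_eq_mul.mp h

theorem map_nsmul (c : Coord p E) (k : ℕ) (u : Fin 2 → ZMod p) :
    c.toFun (k • u) = c.toFun u ^ k := by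
  induction k with
  | zero => simp [c.map_zero]
  | succ k ih => rw [succ_nsmul, c.map_add, ih, pow_succ]

theorem map_smul [NeZero p] (c : Coord p E) (a : ZMod p) (u : Fin 2 → ZMod p) :
    c.toFun (a • u) = c.toFun u ^ a.val := by
  rw [← c.map_nsmul]
  congr 1
  ext j
  simp

/-- The map u ↦ e₁^u₀ e₂^u₁ is a homomorphism with trivial kernel, and counting its p² values shows
that it is onto `E`. -/
theorem exists_of_mem [Fact p.Prime] [Finite G] (hE : IsElemAbelianSq p E) {e₁ e₂ : G}
    (h₁ : e₁ ∈ E) (h₂ : e₂ ∈ E) (h1 : e₁ ≠ 1) (h12 : e₂ ∉ Subgroup.zpowers e₁) :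
    ∃ c : Coord p E, c.toFun (Pi.single 0 1) = e₁ ∧ c.toFun (Pi.single 1 1) = e₂ := by
  obtain ⟨hcard, hpow, hcomm⟩ := hE
  have hp : p.Prime := Fact.out
  let φ : (Fin 2 → ZMod p) → G := fun u => e₁ ^ (u 0).val * e₂ ^ (u 1).val
  have hadd : ∀ u v, φ (u + v) = φ u * φ v := by
    intro u v
    simp only [φ, Pi.add_apply, pow_val_add (hpow _ h₁), pow_val_add (hpow _ h₂)]
    have := hcomm _ (E.pow_mem h₁ (v 0).val) _ (E.pow_mem h₂ (u 1).val)
    rw [mul_assoc, mul_assoc, ← mul_assoc (e₁ ^ (v 0).val), this]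
    simp only [mul_assoc]
  have hker : ∀ u, φ u = 1 → u = 0 := by
    intro u hu
    -- Otherwise e₂^u₁ lies in ⟨e₁⟩, and raising it to the inverse of u₁ mod p puts e₂ itself there.
    have hu1 : u 1 = 0 := by
      by_contra hne
      apply h12
      have h3 : e₂ ^ (u 1).val ∈ Subgroup.zpowers e₁ := by
        rw [← inv_eq_of_mul_eq_one_right hu]
        exact inv_mem (Subgroup.pow_mem _ (Subgroup.mem_zpowers _) _)
      have h4 : e₂ = (e₂ ^ (u 1).val) ^ ((u 1)⁻¹).val := by
        rw [← pow_val_mul (hpow _ h₂), mul_inv_cancel₀ hne, pow_val_one (hpow _ h₂)]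
      rw [h4]
      exact Subgroup.pow_mem _ h3 _
    have hu0 : u 0 = 0 := by
      have h3 : e₁ ^ (u 0).val = e₁ ^ (0 : ZMod p).val := by simpa [φ, hu1] using hu
      exact pow_val_injective (orderOf_eq_prime (hpow _ h₁) h1) h3
    ext j
    fin_cases j
    · exact hu0
    · exact hu1
  have hinj : Function.Injective φ := by
    intro u v huv
    have h3 : φ (u - v) * φ v = φ v := by rw [← hadd, sub_add_cancel, huv]
    exact sub_eq_zero.1 (hker _ (mul_eq_right.1 h3))
  have hrange : Set.range φ = (E : Set G) := by
    apply Set.eq_of_subset_of_ncard_le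
    · rintro _ ⟨u, rfl⟩
      exact E.mul_mem (E.pow_mem h₁ _) (E.pow_mem h₂ _)
    · rw [← Set.image_univ, Set.ncard_image_of_injective _ hinj, Set.ncard_univ,
        ← Nat.card_coe_set_eq]
      refine hcard.le.trans ?_
      simp
    · exact Set.toFinite _
  refine ⟨⟨φ, hadd, hinj, fun z => ?_⟩, ?_, ?_⟩
  · rw [← SetLike.mem_coe, ← hrange, Set.mem_range]
  · simp [φ, ZMod.val_one_eq_one_mod, Nat.mod_eq_of_lt hp.one_lt]
  · simp [φ, ZMod.val_one_eq_one_mod, Nat.mod_eq_of_lt hp.one_lt]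

theorem exists_mem_left [Fact p.Prime] [Finite G] (hE : IsElemAbelianSq p E)
    (K : OrderSubgroup p G) (hK : K.1 ≤ E) :
    ∃ c : Coord p E, c.toFun (Pi.single 0 1) ∈ K.1 := by
  obtain ⟨z, hz, h1⟩ := K.exists_ne_one
  obtain ⟨w, hw, hwK⟩ : ∃ w ∈ E, w ∉ K.1 := by
    by_contra! h
    have h2 : Nat.card E ≤ Nat.card K.1 := Subgroup.card_le_of_le h
    rw [hE.1, K.2] at h2
    have := (Fact.out : p.Prime).one_lt
    nlinarith
  rw [K.eq_zpowers hz h1] at hwK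
  obtain ⟨c, hc, -⟩ := exists_of_mem hE (hK hz) hw h1 hwK
  exact ⟨c, hc ▸ hz⟩

theorem exists_mem_both [Fact p.Prime] [Finite G] (hE : IsElemAbelianSq p E)
    {K K' : OrderSubgroup p G} (hK : K.1 ≤ E) (hK' : K'.1 ≤ E) (hne : K ≠ K') :
    ∃ c : Coord p E, c.toFun (Pi.single 0 1) ∈ K.1 ∧ c.toFun (Pi.single 1 1) ∈ K'.1 := by
  obtain ⟨z, hz, h1⟩ := K.exists_ne_one
  obtain ⟨w, hw, hw1⟩ := K'.exists_ne_one
  have hwK : w ∉ Subgroup.zpowers z := by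
    rw [← K.eq_zpowers hz h1]
    exact fun h => hne (OrderSubgroup.eq_of_mem h hw hw1)
  obtain ⟨c, hc, hc'⟩ := exists_of_mem hE (hK hz) (hK' hw) h1 hwK
  exact ⟨c, hc ▸ hz, hc' ▸ hw⟩

theorem nonempty [Fact p.Prime] [Finite G] (hE : IsElemAbelianSq p E) : Nonempty (Coord p E) := by
  obtain ⟨z, hz, h1⟩ : ∃ z ∈ E, z ≠ 1 := by
    by_contra! h
    have h2 := hE.1
    rw [(Subgroup.eq_bot_iff_forall _).2 h, Subgroup.card_bot] at h2
    exact (one_lt_pow₀ (Fact.out : p.Prime).one_lt two_ne_zero).ne h2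
  let K := OrderSubgroup.ofElement z (hE.2.1 z hz) h1
  obtain ⟨c, -⟩ := exists_mem_left hE K
    (K.le_of_mem (OrderSubgroup.mem_ofElement _ _) h1 hz)
  exact ⟨c⟩

theorem ne_one [Fact p.Prime] (c : Coord p E) {u : Fin 2 → ZMod p} (hu : u ≠ 0) :
    c.toFun u ≠ 1 := by
  rw [← c.map_zero]
  exact c.inj.ne hu

/-- Maps of `E` given by a matrix. -/
theorem exists_mulVec (c : Coord p E) (A : Matrix (Fin 2) (Fin 2) (ZMod p)) :
    ∃ g : G → G, ((∀ x ∈ E, g x ∈ E) ∧ ∀ x ∈ E, ∀ y ∈ E, g (x * y) = g x * g y) ∧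
      ∀ u, g (c.toFun u) = c.toFun (A.mulVec u) := by
  classical
  let g : G → G := fun x => c.toFun (A.mulVec (Function.invFun c.toFun x))
  have hg : ∀ u, g (c.toFun u) = c.toFun (A.mulVec u) := by
    intro u
    simp only [g, Function.leftInverse_invFun c.inj u]
  refine ⟨g, ⟨fun x _ => c.mem _, fun x hx y hy => ?_⟩, hg⟩
  obtain ⟨u, rfl⟩ := (c.mem_iff x).1 hx
  obtain ⟨v, rfl⟩ := (c.mem_iff y).1 hy
  rw [← c.map_add, hg, hg, hg, ← c.map_add, Matrix.mulVec_add]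

end Coord

/-! ### Exponents on stable cyclic subgroups -/

namespace AbelianCover

variable {p : ℕ} {G : Type*} [Group G] {𝒞 : AbelianCover G}

theorem FunRing.map_pow' (f : 𝒞.FunRing) {C : Subgroup G} (hC : C ∈ 𝒞.cells) {x : G}
    (hx : x ∈ C) (k : ℕ) : f (x ^ k) = f x ^ k := by
  induction k with
  | zero => simp [f.map_one']
  | succ k ih => rw [pow_succ, f.map_mul' hC (C.pow_mem hx k) hx, ih, pow_succ]

theorem FunRing.exists_forall_eq_pow [Finite G] (f : 𝒞.FunRing) {C : Subgroup G}
    (hC : C ∈ 𝒞.cells) {w : G} (hw : w ∈ C) (h : f w ∈ Subgroup.zpowers w) :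
    ∃ k : ℕ, ∀ z ∈ Subgroup.zpowers w, f z = z ^ k := by
  obtain ⟨k, hk⟩ := Subgroup.exists_pow_eq h
  refine ⟨k, fun z hz => ?_⟩
  obtain ⟨j, rfl⟩ := Subgroup.exists_pow_eq hz
  rw [f.map_pow' hC hw, ← hk, ← pow_mul, ← pow_mul, mul_comm]

theorem FunRing.exists_zmod [Finite G] (f : 𝒞.FunRing) {C H : Subgroup G}
    (hC : C ∈ 𝒞.cells) (hHC : H ≤ C) (hH : IsCyclic H) (hf : ∀ z ∈ H, f z ∈ H) {n : ℕ}
    (hn : Nat.card H = n) : ∃ c : ZMod n, ∀ z ∈ H, f z = z ^ c.val := by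
  obtain ⟨w, hw, rfl⟩ := Subgroup.exists_generator hH
  obtain ⟨k, hk⟩ := f.exists_forall_eq_pow hC (hHC hw) (hf w hw)
  refine ⟨k, fun z hz => ?_⟩
  rw [hk z hz, pow_val_natCast]
  exact hn ▸ pow_card_of_mem hz

/-- A cyclic subgroup, contained in a cell, that is mapped to itself by the ring of the cover. -/
structure Stable (𝒞 : AbelianCover G) (H : Subgroup G) : Prop where
  cyclic : IsCyclic H
  le_cell : ∃ C ∈ 𝒞.cells, H ≤ C
  map_mem : ∀ (f : 𝒞.FunRing), ∀ z ∈ H, f z ∈ H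

namespace Stable

variable [Finite G] {H : Subgroup G} {n : ℕ}

theorem exists_zmod (h : 𝒞.Stable H) (hn : Nat.card H = n) (f : 𝒞.FunRing) :
    ∃ c : ZMod n, ∀ z ∈ H, f z = z ^ c.val := by
  obtain ⟨C, hC, hHC⟩ := h.le_cell
  exact f.exists_zmod hC hHC h.cyclic (h.map_mem f) hn

theorem eq_of_pow_eq (h : 𝒞.Stable H) (hn : Nat.card H = n) {a b : ZMod n}
    (hab : ∀ z ∈ H, z ^ a.val = z ^ b.val) : a = b := by
  obtain ⟨w, hw, rfl⟩ := Subgroup.exists_generator h.cyclic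
  rw [Nat.card_zpowers] at hn
  have : NeZero n := ⟨hn ▸ (orderOf_pos w).ne'⟩
  exact pow_val_injective hn (hab w hw)

/-- The exponent by which an element of the ring acts on a stable cyclic subgroup. -/
noncomputable def exponent (h : 𝒞.Stable H) (hn : Nat.card H = n) : 𝒞.FunRing →+* ZMod n :=
  have spec := fun f => (h.exists_zmod hn f).choose_spec
  have hz : ∀ z ∈ H, z ^ n = 1 := fun z hz => hn ▸ pow_card_of_mem hz
  have : NeZero n := ⟨hn ▸ Nat.card_pos.ne'⟩
  { toFun := fun f => (h.exists_zmod hn f).choose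
    map_one' := h.eq_of_pow_eq hn fun z hzH => by
      rw [← spec 1 z hzH, pow_val_one (hz z hzH), FunRing.one_apply]
    map_zero' := h.eq_of_pow_eq hn fun z hzH => by
      rw [← spec 0 z hzH, ZMod.val_zero, pow_zero, FunRing.zero_apply]
    map_add' := fun f g => h.eq_of_pow_eq hn fun z hzH => by
      rw [← spec (f + g) z hzH, pow_val_add (hz z hzH), ← spec f z hzH, ← spec g z hzH,
        FunRing.add_apply]
    map_mul' := fun f g => h.eq_of_pow_eq hn fun z hzH => by
      rw [← spec (f * g) z hzH, mul_comm, pow_val_mul (hz z hzH), ← spec g z hzH,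
        ← spec f _ (h.map_mem g z hzH), FunRing.mul_apply] }

theorem apply_eq (h : 𝒞.Stable H) (hn : Nat.card H = n) (f : 𝒞.FunRing) {z : G} (hz : z ∈ H) :
    f z = z ^ (h.exponent hn f).val := (h.exists_zmod hn f).choose_spec z hz

theorem exponent_eq (h : 𝒞.Stable H) (hn : Nat.card H = n) (f : 𝒞.FunRing) {a : ZMod n}
    (ha : ∀ z ∈ H, f z = z ^ a.val) : h.exponent hn f = a :=
  h.eq_of_pow_eq hn fun z hz => by rw [← h.apply_eq hn f hz, ha z hz]

end Stable

end AbelianCover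

/-! ### Matrices of the action on elementary abelian cells -/

namespace Coord

variable {p : ℕ} {G : Type*} [Group G] {𝒞 : AbelianCover G} {E : Subgroup G}

/-- In coordinates the restriction is additive, and additive maps between ℤ/p-modules are linear. -/
theorem exists_matrix (c : Coord p E) (hE : E ∈ 𝒞.cells) (f : 𝒞.FunRing) :
    ∃ A : Matrix (Fin 2) (Fin 2) (ZMod p), ∀ u, f (c.toFun u) = c.toFun (A.mulVec u) := by
  choose L hL using fun u => (c.mem_iff _).1 (f.map_mem hE (c.mem u))
  let φ : (Fin 2 → ZMod p) →+ (Fin 2 → ZMod p) := AddMonoidHom.mk' L fun u v => c.inj (by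
    rw [hL, c.map_add, f.map_mul' hE (c.mem u) (c.mem v), c.map_add, hL, hL])
  refine ⟨LinearMap.toMatrix' (φ.toZModLinearMap p), fun u => ?_⟩
  rw [LinearMap.toMatrix'_mulVec]
  exact (hL u).symm

theorem eq_of_mulVec_eq (c : Coord p E) {A B : Matrix (Fin 2) (Fin 2) (ZMod p)}
    (h : ∀ u, c.toFun (A.mulVec u) = c.toFun (B.mulVec u)) : A = B :=
  Matrix.ext_of_mulVec_single fun _ => c.inj (h _)

/-- The matrix of the action of the ring of a cover on an elementary abelian cell. -/
noncomputable def matrix (c : Coord p E) (hE : E ∈ 𝒞.cells) :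
    𝒞.FunRing →+* Matrix (Fin 2) (Fin 2) (ZMod p) :=
  have spec := fun f => (c.exists_matrix hE f).choose_spec
  { toFun := fun f => (c.exists_matrix hE f).choose
    map_one' := c.eq_of_mulVec_eq fun u => by
      rw [← spec 1 u, Matrix.one_mulVec, AbelianCover.FunRing.one_apply]
    map_zero' := c.eq_of_mulVec_eq fun u => by
      rw [← spec 0 u, Matrix.zero_mulVec, c.map_zero, AbelianCover.FunRing.zero_apply]
    map_add' := fun f g => c.eq_of_mulVec_eq fun u => by
      rw [← spec (f + g) u, Matrix.add_mulVec, c.map_add, ← spec f u, ← spec g u,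
        AbelianCover.FunRing.add_apply]
    map_mul' := fun f g => c.eq_of_mulVec_eq fun u => by
      rw [← spec (f * g) u, ← Matrix.mulVec_mulVec, ← spec f, ← spec g u,
        AbelianCover.FunRing.mul_apply] }

theorem apply_eq (c : Coord p E) (hE : E ∈ 𝒞.cells) (f : 𝒞.FunRing) (u : Fin 2 → ZMod p) :
    f (c.toFun u) = c.toFun ((c.matrix hE f).mulVec u) := (c.exists_matrix hE f).choose_spec u

theorem matrix_eq (c : Coord p E) (hE : E ∈ 𝒞.cells) (f : 𝒞.FunRing)
    {A : Matrix (Fin 2) (Fin 2) (ZMod p)} (h : ∀ u, f (c.toFun u) = c.toFun (A.mulVec u)) :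
    c.matrix hE f = A :=
  c.eq_of_mulVec_eq fun u => by rw [← c.apply_eq hE f u, h u]

theorem eqOn_of_matrix_eq (c : Coord p E) (hE : E ∈ 𝒞.cells) {f g : 𝒞.FunRing}
    (h : c.matrix hE f = c.matrix hE g) {z : G} (hz : z ∈ E) : f z = g z := by
  obtain ⟨u, rfl⟩ := (c.mem_iff z).1 hz
  rw [c.apply_eq hE, c.apply_eq hE, h]

end Coord

theorem IsElemAbelianSq.not_isCyclic {p : ℕ} [Fact p.Prime] {G : Type*} [Group G]
    {E : Subgroup G} (hE : IsElemAbelianSq p E) : ¬ IsCyclic E := by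
  intro h
  have hp : p.Prime := Fact.out
  obtain ⟨w, hw, rfl⟩ := Subgroup.exists_generator h
  have h1 := hE.1
  rw [Nat.card_zpowers] at h1
  have h2 := orderOf_dvd_of_pow_eq_one (hE.2.1 w hw)
  rw [h1] at h2
  have h3 := Nat.le_of_dvd hp.pos h2
  nlinarith [hp.one_lt]

/-! ### Fixed subgroups of order p -/

namespace AbelianCover

variable {p : ℕ} {G : Type*} [Group G] {𝒞 : AbelianCover G}

theorem IsStar.isMaximalCyclic [Fact p.Prime] (h𝒞 : 𝒞.IsStar p) {C : Subgroup G} (hC : C ∈ 𝒞.cells)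
    (h : IsCyclic C) : IsMaximalCyclic C :=
  (h𝒞 C hC).resolve_right fun hE => hE.not_isCyclic h

theorem IsStar.isElemAbelianSq (h𝒞 : 𝒞.IsStar p) {C : Subgroup G} (hC : C ∈ 𝒞.cells)
    (h : ¬ IsCyclic C) : IsElemAbelianSq p C :=
  (h𝒞 C hC).resolve_left fun hE => h hE.1

/-- A subgroup of order `p` that lies in a cyclic cell or in two different cells. -/
def Fixed (𝒞 : AbelianCover G) (K : OrderSubgroup p G) : Prop :=
  ∃ C ∈ 𝒞.cells, K.1 ≤ C ∧ (IsCyclic C ∨ ∃ C' ∈ 𝒞.cells, K.1 ≤ C' ∧ C' ≠ C)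

variable [Fact p.Prime] [Finite G]

theorem FunRing.map_mem_of_le_cyclic (f : 𝒞.FunRing) {C H : Subgroup G} (hC : C ∈ 𝒞.cells)
    (hHC : H ≤ C) (h : IsCyclic C) {z : G} (hz : z ∈ H) : f z ∈ H := by
  obtain ⟨c, hc⟩ := f.exists_zmod hC le_rfl h (fun z hz => f.map_mem hC hz) rfl
  rw [hc z (hHC hz)]
  exact H.pow_mem hz _

/-- On a cyclic cell the ring acts by power maps, which preserve every subgroup. Otherwise `K` lies
in two distinct elementary abelian cells; their intersection is proper in both, so it has order p
and equals `K`, and both cells are preserved. -/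
theorem Fixed.stable (h𝒞 : 𝒞.IsStar p) {K : OrderSubgroup p G} (hK : 𝒞.Fixed K) :
    𝒞.Stable K.1 := by
  obtain ⟨C, hC, hKC, h⟩ := hK
  refine ⟨K.isCyclic, ⟨C, hC, hKC⟩, fun f z hz => ?_⟩
  by_cases hcyc : IsCyclic C
  · exact f.map_mem_of_le_cyclic hC hKC hcyc hz
  obtain ⟨C', hC', hKC', hne⟩ := h.resolve_left hcyc
  by_cases hcyc' : IsCyclic C'
  · exact f.map_mem_of_le_cyclic hC' hKC' hcyc' hz
  have hE := h𝒞.isElemAbelianSq hC hcyc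
  have hE' := h𝒞.isElemAbelianSq hC' hcyc'
  have hle : Nat.card (C ⊓ C' : Subgroup G) ≤ Nat.card K.1 := by
    have hd : Nat.card (C ⊓ C' : Subgroup G) ∣ p ^ 2 :=
      hE.1 ▸ Subgroup.card_dvd_of_le inf_le_left
    obtain ⟨k, hk, hk'⟩ := (Nat.dvd_prime_pow Fact.out).1 hd
    rw [K.2, hk']
    rcases hk.lt_or_eq with h2 | h2
    · calc p ^ k ≤ p ^ 1 := Nat.pow_le_pow_right (Fact.out : p.Prime).pos (by omega)
        _ = p := pow_one p
    · rw [h2] at hk'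
      have h3 := Subgroup.eq_of_le_of_card_ge (inf_le_left : C ⊓ C' ≤ C) (by rw [hE.1, hk'])
      have h4 := Subgroup.eq_of_le_of_card_ge (inf_le_right : C ⊓ C' ≤ C') (by rw [hE'.1, hk'])
      exact absurd (h4.symm.trans h3) hne
  rw [Subgroup.eq_of_le_of_card_ge (le_inf hKC hKC') hle]
  exact ⟨f.map_mem hC (hKC hz), f.map_mem hC' (hKC' hz)⟩

/-- A maximal cyclic subgroup need not be a cell. If it is not, its generator lies in an elementary
abelian cell and has order p, so nothing lies strictly between `K` and `M`. -/
theorem IsStar.cell_eq (h𝒞 : 𝒞.IsStar p) {K : OrderSubgroup p G} {M : Subgroup G}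
    (hM : IsMaximalCyclic M) (hKM : K.1 ≤ M) : M ∈ 𝒞.cells ∨ M = K.1 := by
  obtain ⟨w, hw, hMw⟩ := Subgroup.exists_generator hM.1
  obtain ⟨C, hC, hwC⟩ := 𝒞.covers w
  have hMC : M ≤ C := by rw [hMw]; simpa using hwC
  rcases h𝒞 C hC with h | h
  · left
    rwa [hM.eq_of_le h.1 hMC]
  · right
    refine (Subgroup.eq_of_le_of_card_ge hKM ?_).symm
    rw [K.2, hMw, Nat.card_zpowers]
    exact Nat.le_of_dvd (Fact.out : p.Prime).pos (orderOf_dvd_of_pow_eq_one (h.2.1 w hwC))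

theorem Fixed.stable_above (h𝒞 : 𝒞.IsStar p) {K : OrderSubgroup p G} (hK : 𝒞.Fixed K)
    (M : MaxCyclicAbove K.1) : 𝒞.Stable M.1 := by
  rcases h𝒞.cell_eq M.2.1 M.2.2 with h | h
  · exact ⟨M.2.1.1, ⟨M.1, h, le_rfl⟩, fun f z hz => f.map_mem h hz⟩
  · rw [h]
    exact hK.stable h𝒞

end AbelianCover

/-! ### Types of cells and the invariants of an element -/

namespace AbelianCover

/-- The fixed subgroups of order `p`. -/
abbrev FixedSubgroup (p : ℕ) {G : Type*} [Group G] (𝒞 : AbelianCover G) : Type _ :=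
  {K : OrderSubgroup p G // 𝒞.Fixed K}

/-- The elementary abelian cells without fixed subgroups. -/
abbrev FreeCell (p : ℕ) {G : Type*} [Group G] (𝒞 : AbelianCover G) : Type _ :=
  {E : Subgroup G // E ∈ 𝒞.cells ∧ IsElemAbelianSq p E ∧
    ∀ K : FixedSubgroup p 𝒞, ¬ K.1.1 ≤ E}

/-- The elementary abelian cells with a unique fixed subgroup, paired with that subgroup. -/
abbrev PointedCell (p : ℕ) {G : Type*} [Group G] (𝒞 : AbelianCover G) : Type _ :=
  {E : FixedSubgroup p 𝒞 × Subgroup G // E.2 ∈ 𝒞.cells ∧ IsElemAbelianSq p E.2 ∧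
    E.1.1.1 ≤ E.2 ∧ ∀ K : FixedSubgroup p 𝒞, K.1.1 ≤ E.2 → K = E.1}

/-- Two fixed subgroups are linked if they lie in an elementary abelian cell that contains a
further fixed subgroup. -/
def Linked {p : ℕ} {G : Type*} [Group G] {𝒞 : AbelianCover G} (K K' : FixedSubgroup p 𝒞) : Prop :=
  ∃ E ∈ 𝒞.cells, IsElemAbelianSq p E ∧ K.1.1 ≤ E ∧ K'.1.1 ≤ E ∧
    ∃ K'' : FixedSubgroup p 𝒞, K''.1.1 ≤ E ∧ K'' ≠ K ∧ K'' ≠ K'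

/-- Each z is evaluated in an arbitrarily chosen cell containing it; compatibility makes the choice
irrelevant. -/
theorem FunRing.exists_glue {G : Type*} [Group G] {𝒞 : AbelianCover G} (F : Subgroup G → G → G)
    (hF : ∀ C ∈ 𝒞.cells, (∀ x ∈ C, F C x ∈ C) ∧ ∀ x ∈ C, ∀ y ∈ C, F C (x * y) = F C x * F C y)
    (hcompat : ∀ C ∈ 𝒞.cells, ∀ C' ∈ 𝒞.cells, ∀ z ∈ C, z ∈ C' → F C z = F C' z) :
    ∃ f : 𝒞.FunRing, ∀ C ∈ 𝒞.cells, ∀ z ∈ C, f z = F C z := by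
  choose cell hcell hmem using 𝒞.covers
  have key : ∀ C ∈ 𝒞.cells, ∀ z ∈ C, F (cell z) z = F C z := fun C hC z hz =>
    hcompat _ (hcell z) C hC z (hmem z) hz
  refine ⟨⟨fun z => F (cell z) z, fun C hC => ⟨fun x hx => ?_, fun x hx y hy => ?_⟩⟩, key⟩
  · simp only [key C hC x hx]
    exact (hF C hC).1 x hx
  · simp only [key C hC _ (C.mul_mem hx hy), key C hC x hx, key C hC y hy]
    exact (hF C hC).2 x hx y hy

variable {p : ℕ} [Fact p.Prime] {G : Type*} [Group G] {𝒞 : AbelianCover G} [Finite G]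

/-- Coordinates of a cell without fixed subgroups. -/
noncomputable def FreeCell.coord (E : FreeCell p 𝒞) : Coord p E.1 :=
  (Coord.nonempty E.2.2.1).some

/-- Coordinates of a cell with a unique fixed subgroup, the first basis vector lying in that
subgroup. -/
noncomputable def PointedCell.coord (E : PointedCell p 𝒞) : Coord p E.1.2 :=
  (Coord.exists_mem_left E.2.2.1 E.1.1.1 E.2.2.2.1).choose

theorem PointedCell.coord_mem (E : PointedCell p 𝒞) :
    E.coord.toFun (Pi.single 0 1) ∈ E.1.1.1.1 :=
  (Coord.exists_mem_left E.2.2.1 E.1.1.1 E.2.2.2.1).choose_spec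

/-- The scalar by which the ring acts on a fixed subgroup. -/
noncomputable def scalar (h𝒞 : 𝒞.IsStar p) (K : FixedSubgroup p 𝒞) : 𝒞.FunRing →+* ZMod p :=
  (K.2.stable h𝒞).exponent K.1.2

/-- The exponents by which the ring acts on the maximal cyclic subgroups above a fixed subgroup. -/
noncomputable def tuple (h𝒞 : 𝒞.IsStar p) (K : FixedSubgroup p 𝒞) :
    𝒞.FunRing →+* ∀ M : MaxCyclicAbove K.1.1, ZMod (Nat.card M.1) :=
  RingHom.pi fun M => (K.2.stable_above h𝒞 M).exponent rfl

theorem apply_scalar (h𝒞 : 𝒞.IsStar p) (K : FixedSubgroup p 𝒞) (f : 𝒞.FunRing) {z : G}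
    (hz : z ∈ K.1.1) : f z = z ^ (scalar h𝒞 K f).val :=
  (K.2.stable h𝒞).apply_eq K.1.2 f hz

theorem apply_tuple (h𝒞 : 𝒞.IsStar p) (K : FixedSubgroup p 𝒞) (f : 𝒞.FunRing)
    (M : MaxCyclicAbove K.1.1) {z : G} (hz : z ∈ M.1) : f z = z ^ (tuple h𝒞 K f M).val :=
  (K.2.stable_above h𝒞 M).apply_eq rfl f hz

theorem tuple_mem (h𝒞 : 𝒞.IsStar p) (K : FixedSubgroup p 𝒞) (f : 𝒞.FunRing) :
    tuple h𝒞 K f ∈ tupleSet K.1 (scalar h𝒞 K f) := by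
  refine ⟨fun M M' z hz hz' => ?_, fun M z hz => ?_⟩
  · rw [← apply_tuple h𝒞 K f M hz, ← apply_tuple h𝒞 K f M' hz']
  · rw [← apply_tuple h𝒞 K f M (M.2.2 hz), ← apply_scalar h𝒞 K f hz]

theorem matrix_mulVec_of_mem (h𝒞 : 𝒞.IsStar p) (K : FixedSubgroup p 𝒞) (f : 𝒞.FunRing)
    {E : Subgroup G} (hE : E ∈ 𝒞.cells) (c : Coord p E) {u : Fin 2 → ZMod p}
    (hu : c.toFun u ∈ K.1.1) : (c.matrix hE f).mulVec u = scalar h𝒞 K f • u := by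
  apply c.inj
  rw [← c.apply_eq hE, apply_scalar h𝒞 K f hu, c.map_smul]

theorem matrix_apply_of_mem (h𝒞 : 𝒞.IsStar p) (K : FixedSubgroup p 𝒞) (f : 𝒞.FunRing)
    {E : Subgroup G} (hE : E ∈ 𝒞.cells) (c : Coord p E) {j : Fin 2}
    (hj : c.toFun (Pi.single j 1) ∈ K.1.1) (i : Fin 2) :
    c.matrix hE f i j = if i = j then scalar h𝒞 K f else 0 := by
  have h := congrFun (matrix_mulVec_of_mem h𝒞 K f hE c hj) i
  simpa [Pi.single_apply] using h

/-- A vector in coordinates adapted to two subgroups that lies in a third one has no vanishing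
coordinate. -/
theorem coord_ne_zero {E : Subgroup G} (c : Coord p E) {K : OrderSubgroup p G} {j : Fin 2}
    (hj : c.toFun (Pi.single j 1) ∈ K.1) {K' : OrderSubgroup p G} (hne : K' ≠ K)
    {u : Fin 2 → ZMod p} (hu : c.toFun u ∈ K'.1) (h1 : c.toFun u ≠ 1) {i : Fin 2} (hi : i ≠ j) :
    u i ≠ 0 := by
  intro h
  have h2 : u = u j • Pi.single j 1 := by
    ext k
    by_cases hk : k = j
    · subst hk; simp
    · have : k = i := by omega
      subst this
      simp [h, hk]
  apply hne
  refine OrderSubgroup.eq_of_mem hu ?_ h1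
  rw [h2, c.map_smul]
  exact K.1.pow_mem hj _

/-- In a basis taken from K and K' the matrix is diagonal. The third fixed subgroup supplies an
eigenvector with both coordinates nonzero, so both diagonal entries equal its eigenvalue. -/
theorem Linked.scalar_eq (h𝒞 : 𝒞.IsStar p) {K K' : FixedSubgroup p 𝒞} (h : Linked K K')
    (f : 𝒞.FunRing) : scalar h𝒞 K f = scalar h𝒞 K' f := by
  by_cases hKK : K = K'
  · rw [hKK]
  obtain ⟨E, hE, hElem, hK, hK', K'', hK'', hne, hne'⟩ := h
  obtain ⟨c, h0, h1⟩ := Coord.exists_mem_both hElem hK hK' fun h => hKK (Subtype.ext h)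
  obtain ⟨z, hz, hz1⟩ := K''.1.exists_ne_one
  obtain ⟨u, rfl⟩ := (c.mem_iff z).1 (hK'' hz)
  have hu0 : u 0 ≠ 0 := coord_ne_zero c h1 (fun h => hne' (Subtype.ext h)) hz hz1 (by decide)
  have hu1 : u 1 ≠ 0 := coord_ne_zero c h0 (fun h => hne (Subtype.ext h)) hz hz1 (by decide)
  have key := matrix_mulVec_of_mem h𝒞 K'' f hE c hz
  have k0 := congrFun key 0
  have k1 := congrFun key 1
  simp only [Matrix.mulVec, dotProduct, Fin.sum_univ_two, matrix_apply_of_mem h𝒞 K f hE c h0,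
    matrix_apply_of_mem h𝒞 K' f hE c h1, Pi.smul_apply, smul_eq_mul] at k0 k1
  simp only [↓reduceIte, zero_ne_one, one_ne_zero, zero_mul, add_zero, zero_add] at k0 k1
  rw [mul_right_cancel₀ hu0 k0, mul_right_cancel₀ hu1 k1]

/-- Injectivity of the final isomorphism. On cells with two or more fixed subgroups the scalars
already give the whole matrix; with exactly one they give the first column. -/
theorem FunRing.eq_of_data (hG : IsPGroup p G) (h𝒞 : 𝒞.IsStar p) {f g : 𝒞.FunRing}
    (hs : ∀ K, scalar h𝒞 K f = scalar h𝒞 K g) (ht : ∀ K, tuple h𝒞 K f = tuple h𝒞 K g)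
    (hp : ∀ (E : PointedCell p 𝒞) i, E.coord.matrix E.2.1 f i 1 = E.coord.matrix E.2.1 g i 1)
    (hf : ∀ E : FreeCell p 𝒞, E.coord.matrix E.2.1 f = E.coord.matrix E.2.1 g) : f = g := by
  ext z
  by_cases h1 : z = 1
  · rw [h1, f.map_one', g.map_one']
  obtain ⟨C, hC, hz⟩ := 𝒞.covers z
  rcases h𝒞 C hC with hcyc | hElem
  · obtain ⟨K, hK⟩ := OrderSubgroup.exists_le_zpowers hG h1
    have hKC : K.1 ≤ C := hK.trans (by simpa using hz)
    have hfix : 𝒞.Fixed K := ⟨C, hC, hKC, Or.inl hcyc.1⟩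
    rw [apply_tuple h𝒞 ⟨K, hfix⟩ f ⟨C, hcyc, hKC⟩ hz, ht,
      ← apply_tuple h𝒞 ⟨K, hfix⟩ g ⟨C, hcyc, hKC⟩ hz]
  · by_cases h0 : ∃ K : FixedSubgroup p 𝒞, K.1.1 ≤ C
    · obtain ⟨K, hK⟩ := h0
      by_cases h2 : ∃ K' : FixedSubgroup p 𝒞, K'.1.1 ≤ C ∧ K ≠ K'
      · obtain ⟨K', hK', hne⟩ := h2
        obtain ⟨c, h0, h1⟩ := Coord.exists_mem_both hElem hK hK' fun h => hne (Subtype.ext h)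
        refine c.eqOn_of_matrix_eq hC (Matrix.ext fun i j => ?_) hz
        fin_cases j
        · exact (matrix_apply_of_mem h𝒞 K f hC c h0 i).trans
            (hs K ▸ (matrix_apply_of_mem h𝒞 K g hC c h0 i).symm)
        · exact (matrix_apply_of_mem h𝒞 K' f hC c h1 i).trans
            (hs K' ▸ (matrix_apply_of_mem h𝒞 K' g hC c h1 i).symm)
      · push Not at h2
        let E : PointedCell p 𝒞 := ⟨(K, C), hC, hElem, hK, fun K' hK' => (h2 K' hK').symm⟩
        refine E.coord.eqOn_of_matrix_eq hC (Matrix.ext fun i j => ?_) hz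
        fin_cases j
        · exact (matrix_apply_of_mem h𝒞 K f hC E.coord E.coord_mem i).trans
            (hs K ▸ (matrix_apply_of_mem h𝒞 K g hC E.coord E.coord_mem i).symm)
        · exact hp E i
    · push Not at h0
      exact (FreeCell.coord ⟨C, hC, hElem, h0⟩).eqOn_of_matrix_eq hC (hf ⟨C, hC, hElem, h0⟩) hz

end AbelianCover

/-! ### Realizing prescribed data -/

theorem Coord.exists_smul_of_mem {p : ℕ} [Fact p.Prime] {G : Type*} [Group G] [Finite G]
    {E : Subgroup G} (c : Coord p E) {K : OrderSubgroup p G} {j : Fin 2}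
    (hj : c.toFun (Pi.single j 1) ∈ K.1) {z : G} (hz : z ∈ K.1) :
    ∃ a : ZMod p, c.toFun (a • Pi.single j 1) = z := by
  rw [K.eq_zpowers hj (c.ne_one (by simp))] at hz
  obtain ⟨k, rfl⟩ := Subgroup.exists_pow_eq hz
  exact ⟨k, by rw [← c.map_nsmul, Nat.cast_smul_eq_nsmul]⟩

theorem Coord.eq_pow_of_mulVec {p : ℕ} [Fact p.Prime] {G : Type*} [Group G] [Finite G]
    {E : Subgroup G} (c : Coord p E) {A : Matrix (Fin 2) (Fin 2) (ZMod p)} {g : G → G}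
    (hg : ∀ u, g (c.toFun u) = c.toFun (A.mulVec u)) {K : OrderSubgroup p G} {j : Fin 2}
    (hj : c.toFun (Pi.single j 1) ∈ K.1) {l : ZMod p}
    (hA : A.mulVec (Pi.single j 1) = l • Pi.single j 1) {z : G} (hz : z ∈ K.1) :
    g z = z ^ l.val := by
  obtain ⟨a, rfl⟩ := c.exists_smul_of_mem hj hz
  rw [hg, Matrix.mulVec_smul, hA, smul_comm, c.map_smul]

namespace AbelianCover

variable {p : ℕ} [Fact p.Prime] {G : Type*} [Group G] {𝒞 : AbelianCover G} [Finite G]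

/-- Prescribed data of an element of the ring of a cover. -/
structure ActionData (p : ℕ) [Fact p.Prime] {G : Type*} [Group G] [Finite G]
    (𝒞 : AbelianCover G) where
  lam : FixedSubgroup p 𝒞 → ZMod p
  lam_eq : ∀ K K', Linked K K' → lam K = lam K'
  tup : ∀ (K : FixedSubgroup p 𝒞) (M : MaxCyclicAbove K.1.1), ZMod (Nat.card M.1)
  tup_mem : ∀ K, tup K ∈ tupleSet K.1 (lam K)
  ν : PointedCell p 𝒞 → ZMod p
  μ : PointedCell p 𝒞 → ZMod p
  A : FreeCell p 𝒞 → Matrix (Fin 2) (Fin 2) (ZMod p)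

namespace ActionData

/-- The map `g` is an endomorphism of `C` that realizes the data. -/
structure Realizes (d : ActionData p 𝒞) (C : Subgroup G) (g : G → G) : Prop where
  endo : (∀ x ∈ C, g x ∈ C) ∧ ∀ x ∈ C, ∀ y ∈ C, g (x * y) = g x * g y
  lam : ∀ K : FixedSubgroup p 𝒞, K.1.1 ≤ C → ∀ z ∈ K.1.1, g z = z ^ (d.lam K).val
  tup : ∀ (K : FixedSubgroup p 𝒞) (M : MaxCyclicAbove K.1.1), M.1 = C →
    ∀ z ∈ C, g z = z ^ (d.tup K M).val
  pointed : ∀ E : PointedCell p 𝒞, E.1.2 = C → ∀ u,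
    g (E.coord.toFun u) = E.coord.toFun ((!![d.lam E.1.1, d.ν E; 0, d.μ E]).mulVec u)
  free : ∀ E : FreeCell p 𝒞, E.1 = C → ∀ u,
    g (E.coord.toFun u) = E.coord.toFun ((d.A E).mulVec u)

theorem exists_realizes_cyclic (hG : IsPGroup p G) (h𝒞 : 𝒞.IsStar p) (d : ActionData p 𝒞)
    {C : Subgroup G} (hC : C ∈ 𝒞.cells) (hcyc : IsCyclic C) : ∃ g, d.Realizes C g := by
  by_cases h : ∃ K : OrderSubgroup p G, K.1 ≤ C
  · obtain ⟨K, hKC⟩ := h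
    let K₀ : FixedSubgroup p 𝒞 := ⟨K, C, hC, hKC, Or.inl hcyc⟩
    let M : MaxCyclicAbove K₀.1.1 := ⟨C, h𝒞.isMaximalCyclic hC hcyc, hKC⟩
    refine ⟨fun z => z ^ (d.tup K₀ M).val, ⟨fun x hx => C.pow_mem hx _, fun x hx y hy =>
      (show Commute x y from 𝒞.comm C hC x hx y hy).mul_pow _⟩, ?_, ?_, ?_, ?_⟩
    · intro K' hK' z hz
      obtain rfl : K' = K₀ := Subtype.ext (OrderSubgroup.eq_of_le_cyclic hcyc hK' hKC)
      exact (d.tup_mem K₀).2 M z hz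
    · intro K' M' hM' z hz
      obtain rfl : K' = K₀ :=
        Subtype.ext (OrderSubgroup.eq_of_le_cyclic hcyc (hM' ▸ M'.2.2) hKC)
      obtain rfl : M' = M := Subtype.ext hM'
      rfl
    · rintro E rfl
      exact absurd hcyc E.2.2.1.not_isCyclic
    · rintro E rfl
      exact absurd hcyc E.2.2.1.not_isCyclic
  -- Only the trivial cell contains no subgroup of order p.
  · have htriv : ∀ z ∈ C, z = 1 := by
      intro z hz
      by_contra h1
      obtain ⟨K, hK⟩ := OrderSubgroup.exists_le_zpowers hG h1
      exact h ⟨K, hK.trans (by simpa using hz)⟩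
    refine ⟨id, ⟨fun x hx => hx, fun _ _ _ _ => rfl⟩, ?_, ?_, ?_, ?_⟩
    · intro K hK
      exact absurd ⟨K.1, hK⟩ h
    · intro K M hM z hz
      rw [htriv z hz]
      simp
    · rintro E rfl
      exact absurd hcyc E.2.2.1.not_isCyclic
    · rintro E rfl
      exact absurd hcyc E.2.2.1.not_isCyclic

theorem exists_realizes_elem (d : ActionData p 𝒞) {C : Subgroup G} (hC : C ∈ 𝒞.cells)
    (hElem : IsElemAbelianSq p C) : ∃ g, d.Realizes C g := by
  have htup : ∀ (g : G → G) (K : FixedSubgroup p 𝒞) (M : MaxCyclicAbove K.1.1), M.1 = C →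
      ∀ z ∈ C, g z = z ^ (d.tup K M).val := by
    rintro g K M rfl
    exact absurd M.2.1.1 hElem.not_isCyclic
  by_cases h0 : ∃ K : FixedSubgroup p 𝒞, K.1.1 ≤ C
  · obtain ⟨K, hK⟩ := h0
    have hfree : ∀ g : G → G, ∀ E : FreeCell p 𝒞, E.1 = C → ∀ u,
        g (E.coord.toFun u) = E.coord.toFun ((d.A E).mulVec u) := by
      rintro g E rfl
      exact absurd hK (E.2.2.2 K)
    by_cases h2 : ∃ K' : FixedSubgroup p 𝒞, K'.1.1 ≤ C ∧ K ≠ K'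
    · obtain ⟨K', hK', hne⟩ := h2
      obtain ⟨c, h0, h1⟩ := Coord.exists_mem_both hElem hK hK' fun h => hne (Subtype.ext h)
      obtain ⟨g, hg, hgc⟩ := c.exists_mulVec (Matrix.diagonal ![d.lam K, d.lam K'])
      refine ⟨g, hg, fun L hL z hz => ?_, htup g, ?_, hfree g⟩
      · by_cases hLK : L = K
        · subst hLK
          refine c.eq_pow_of_mulVec hgc h0 ?_ hz
          ext i
          fin_cases i <;> simp
        by_cases hLK' : L = K'
        · subst hLK'
          refine c.eq_pow_of_mulVec hgc h1 ?_ hz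
          ext i
          fin_cases i <;> simp
        -- A third fixed subgroup `L` links K with K', while K' links K with `L`; hence the diagonal
        -- matrix is scalar, with the value prescribed on `L`.
        have e1 : d.lam K = d.lam K' :=
          d.lam_eq _ _ ⟨C, hC, hElem, hK, hK', L, hL, hLK, hLK'⟩
        have e2 : d.lam K = d.lam L :=
          d.lam_eq _ _ ⟨C, hC, hElem, hK, hL, K', hK', hne.symm, Ne.symm hLK'⟩
        obtain ⟨u, rfl⟩ := (c.mem_iff z).1 (hL hz)
        rw [hgc, ← c.map_smul]
        congr 1
        ext i
        fin_cases i <;> simp [Matrix.mulVec_diagonal, ← e1, ← e2]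
      · rintro E rfl
        exact absurd ((E.2.2.2.2 K hK).trans (E.2.2.2.2 K' hK').symm) hne
    · push Not at h2
      let E : PointedCell p 𝒞 := ⟨(K, C), hC, hElem, hK, fun K' hK' => (h2 K' hK').symm⟩
      obtain ⟨g, hg, hgc⟩ := E.coord.exists_mulVec !![d.lam E.1.1, d.ν E; 0, d.μ E]
      refine ⟨g, hg, fun L hL z hz => ?_, htup g, ?_, hfree g⟩
      · obtain rfl := h2 L hL
        refine E.coord.eq_pow_of_mulVec hgc E.coord_mem ?_ hz
        ext i
        fin_cases i <;> simp [E]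
      · intro E' hE'
        obtain rfl : E' = E :=
          Subtype.ext (Prod.ext (h2 E'.1.1 (hE' ▸ E'.2.2.2.1)).symm hE')
        exact hgc
  · push Not at h0
    let E : FreeCell p 𝒞 := ⟨C, hC, hElem, h0⟩
    obtain ⟨g, hg, hgc⟩ := E.coord.exists_mulVec (d.A E)
    refine ⟨g, hg, fun L hL => absurd hL (h0 L), htup g, ?_, ?_⟩
    · intro E' hE'
      exact absurd (hE' ▸ E'.2.2.2.1) (h0 E'.1.1)
    · intro E' hE'
      obtain rfl : E' = E := Subtype.ext hE'
      exact hgc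

theorem Realizes.map_one {d : ActionData p 𝒞} {C : Subgroup G} {g : G → G}
    (h : d.Realizes C g) : g 1 = 1 := by
  have h1 := h.endo.2 1 C.one_mem 1 C.one_mem
  rw [mul_one] at h1
  exact left_eq_mul.mp h1

theorem Realizes.eq_of_pow_eq_one {d : ActionData p 𝒞} {C C' : Subgroup G} {g g' : G → G}
    (hC : C ∈ 𝒞.cells) (hC' : C' ∈ 𝒞.cells) (hne : C' ≠ C) (h : d.Realizes C g)
    (h' : d.Realizes C' g') {z : G} (hz : z ∈ C) (hz' : z ∈ C') (h1 : z ≠ 1) (hp : z ^ p = 1) :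
    g z = g' z := by
  let K := OrderSubgroup.ofElement z hp h1
  have hK : z ∈ K.1 := OrderSubgroup.mem_ofElement hp h1
  have hKC := K.le_of_mem hK h1 hz
  have hKC' := K.le_of_mem hK h1 hz'
  have hfix : 𝒞.Fixed K := ⟨C, hC, hKC, Or.inr ⟨C', hC', hKC', hne⟩⟩
  rw [h.lam ⟨K, hfix⟩ hKC z hK, h'.lam ⟨K, hfix⟩ hKC' z hK]

/-- Agreement on overlaps. If one of the cells is elementary abelian, a common element z ≠ 1 has
order p and generates a fixed subgroup, where both maps are the prescribed power. If both are
maximal cyclic, compatibility of the tuple applies. -/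
theorem Realizes.eq (hG : IsPGroup p G) (h𝒞 : 𝒞.IsStar p) {d : ActionData p 𝒞}
    {C C' : Subgroup G} {g g' : G → G}
    (hC : C ∈ 𝒞.cells) (hC' : C' ∈ 𝒞.cells) (hne : C' ≠ C) (h : d.Realizes C g)
    (h' : d.Realizes C' g') {z : G} (hz : z ∈ C) (hz' : z ∈ C') : g z = g' z := by
  by_cases h1 : z = 1
  · rw [h1, h.map_one, h'.map_one]
  rcases h𝒞 C hC with hM | hE
  · rcases h𝒞 C' hC' with hM' | hE'
    · obtain ⟨K, hK⟩ := OrderSubgroup.exists_le_zpowers hG h1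
      have hKC : K.1 ≤ C := hK.trans (by simpa using hz)
      have hKC' : K.1 ≤ C' := hK.trans (by simpa using hz')
      have hfix : 𝒞.Fixed K := ⟨C, hC, hKC, Or.inl hM.1⟩
      rw [h.tup ⟨K, hfix⟩ ⟨C, hM, hKC⟩ rfl z hz, h'.tup ⟨K, hfix⟩ ⟨C', hM', hKC'⟩ rfl z hz']
      exact (d.tup_mem ⟨K, hfix⟩).1 _ _ z hz hz'
    · exact h.eq_of_pow_eq_one hC hC' hne h' hz hz' h1 (hE'.2.1 z hz')
  · exact h.eq_of_pow_eq_one hC hC' hne h' hz hz' h1 (hE.2.1 z hz)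

theorem exists_funRing (hG : IsPGroup p G) (h𝒞 : 𝒞.IsStar p) (d : ActionData p 𝒞) :
    ∃ f : 𝒞.FunRing, (∀ K, scalar h𝒞 K f = d.lam K) ∧ (∀ K, tuple h𝒞 K f = d.tup K) ∧
      (∀ E : PointedCell p 𝒞,
        E.coord.matrix E.2.1 f = !![d.lam E.1.1, d.ν E; 0, d.μ E]) ∧
      ∀ E : FreeCell p 𝒞, E.coord.matrix E.2.1 f = d.A E := by
  have key : ∀ C, ∃ g, C ∈ 𝒞.cells → d.Realizes C g := by
    intro C
    by_cases hC : C ∈ 𝒞.cells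
    · obtain ⟨g, hg⟩ : ∃ g, d.Realizes C g := by
        rcases h𝒞 C hC with h | h
        · exact d.exists_realizes_cyclic hG h𝒞 hC h.1
        · exact d.exists_realizes_elem hC h
      exact ⟨g, fun _ => hg⟩
    · exact ⟨id, fun h => absurd h hC⟩
  choose F hF using key
  obtain ⟨f, hf⟩ := FunRing.exists_glue F (fun C hC => (hF C hC).endo) fun C hC C' hC' z hz hz' => by
    by_cases hne : C' = C
    · rw [hne]
    · exact (hF C hC).eq hG h𝒞 hC hC' hne (hF C' hC') hz hz'
  have hlam : ∀ K : FixedSubgroup p 𝒞, ∀ z ∈ K.1.1, f z = z ^ (d.lam K).val := by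
    intro K z hz
    obtain ⟨C, hC, hKC⟩ := (K.2.stable h𝒞).le_cell
    rw [hf C hC z (hKC hz), (hF C hC).lam K hKC z hz]
  refine ⟨f, fun K => ?_, fun K => funext fun M => ?_, fun E => ?_, fun E => ?_⟩
  · exact (K.2.stable h𝒞).exponent_eq K.1.2 f (hlam K)
  · refine (K.2.stable_above h𝒞 M).exponent_eq rfl f fun z hz => ?_
    rcases h𝒞.cell_eq M.2.1 M.2.2 with hM | hM
    · rw [hf _ hM z hz, (hF _ hM).tup K M rfl z hz]
    -- Here M = K and `M` may fail to be a cell; its exponent is then forced by the scalar.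
    · rw [hM] at hz
      rw [hlam K z hz, (d.tup_mem K).2 M z hz]
  · refine E.coord.matrix_eq E.2.1 f fun u => ?_
    rw [hf _ E.2.1 _ (E.coord.mem u), (hF _ E.2.1).pointed E rfl]
  · refine E.coord.matrix_eq E.2.1 f fun u => ?_
    rw [hf _ E.2.1 _ (E.coord.mem u), (hF _ E.2.1).free E rfl]

end ActionData

end AbelianCover

/-! ### Assembling the direct product -/

/-- Sorts fixed subgroups and pointed cells by class through the same enumeration `e`, so that their
class indices match. Fibres may be empty, which gives n = 0. -/
theorem exists_sigma_equiv_fiber {X Y : Type*} [Finite X] {t : ℕ} (e : Fin t ≃ Y) (π : X → Y) :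
    ∃ (m : Fin t → ℕ) (σ : (Σ j, Fin (m j)) ≃ X), ∀ j a, π (σ ⟨j, a⟩) = e j := by
  refine ⟨fun j => Nat.card {x // e.symm (π x) = j},
    (Equiv.sigmaCongrRight fun j => (Finite.equivFin _).symm).trans
      (Equiv.sigmaFiberEquiv fun x => e.symm (π x)), fun j a => ?_⟩
  exact e.symm_apply_eq.1 ((Finite.equivFin {x // e.symm (π x) = j}).symm a).2

theorem blockMatrix_inj {R : Type*} [CommRing R] {m n : ℕ} (hm : 0 < m) {i : Fin n → Fin m}
    {l l' : R} {ν ν' μ μ' : Fin n → R} (h : blockMatrix i l ν μ = blockMatrix i l' ν' μ') :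
    l = l' ∧ ν = ν' ∧ μ = μ' := by
  refine ⟨?_, funext fun b => ?_, funext fun b => ?_⟩
  · simpa [blockMatrix] using congrFun (congrFun h (Sum.inl ⟨0, hm⟩)) (Sum.inl ⟨0, hm⟩)
  · simpa [blockMatrix] using congrFun (congrFun h (Sum.inl (i b))) (Sum.inr b)
  · simpa [blockMatrix] using congrFun (congrFun h (Sum.inr b)) (Sum.inr b)

namespace AbelianCover

variable {p : ℕ} [Fact p.Prime] {G : Type*} [Group G] {𝒞 : AbelianCover G} [Finite G]

/-- The block matrices of the action of the ring on cells with a unique fixed subgroup, if the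
scalars on these subgroups are all given by `l`. -/
noncomputable def blockHom (h𝒞 : 𝒞.IsStar p) {m n : ℕ} (i : Fin n → Fin m)
    (l : 𝒞.FunRing →+* ZMod p) (E : Fin n → PointedCell p 𝒞)
    (hE : ∀ b, scalar h𝒞 (E b).1.1 = l) :
    𝒞.FunRing →+* Matrix (Fin m ⊕ Fin n) (Fin m ⊕ Fin n) (ZMod p) where
  toFun f := blockMatrix i (l f) (fun b => (E b).coord.matrix (E b).2.1 f 0 1)
    (fun b => (E b).coord.matrix (E b).2.1 f 1 1)
  map_one' := by
    rw [← blockMatrix_one i]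
    congr 1 <;> simp [funext_iff]
  map_zero' := by
    rw [← blockMatrix_zero i]
    congr 1 <;> simp [funext_iff]
  map_add' f g := by
    rw [blockMatrix_add]
    congr 1 <;> simp [funext_iff]
  map_mul' f g := by
    -- The first column of each 2 × 2 matrix is (l, 0), so the second column multiplies as in
    -- `blockMatrix_mul`.
    have h (f : 𝒞.FunRing) (b : Fin n) (k : Fin 2) :=
      matrix_apply_of_mem h𝒞 (E b).1.1 f (E b).2.1 (E b).coord (E b).coord_mem k
    rw [blockMatrix_mul]
    congr 1
    · simp
    · funext b
      simp [Matrix.mul_apply, Fin.sum_univ_two, h, hE]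
    · funext b
      simp [Matrix.mul_apply, Fin.sum_univ_two, h]

/-- The projection of the ring of a cover to one of the subdirect products. -/
noncomputable def subdirectHom (h𝒞 : 𝒞.IsStar p) (D : SubdirectData p G)
    (hK : ∀ a, 𝒞.Fixed (D.K a)) (l : 𝒞.FunRing →+* ZMod p)
    (hl : ∀ a, scalar h𝒞 ⟨D.K a, hK a⟩ = l) (E : Fin D.n → PointedCell p 𝒞)
    (hE : ∀ b, scalar h𝒞 (E b).1.1 = l) : 𝒞.FunRing →+* D.ring :=
  RingHom.codRestrict
    (RingHom.prod
      (RingHom.codRestrict (blockHom h𝒞 D.i l E hE) (blockMatrixRing (ZMod p) D.i)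
        fun f => show blockHom h𝒞 D.i l E hE f ∈ blockMatrixRing (ZMod p) D.i from
          ⟨l f, _, _, rfl⟩)
      (RingHom.pi fun a => RingHom.codRestrict (tuple h𝒞 ⟨D.K a, hK a⟩) (tupleRing (D.K a))
        fun f => ⟨_, tuple_mem h𝒞 ⟨D.K a, hK a⟩ f⟩)) D.ring
    fun f => ⟨_, _, _, rfl, fun a => hl a ▸ tuple_mem h𝒞 ⟨D.K a, hK a⟩ f⟩

end AbelianCover

open AbelianCover in
theorem mainTheorem1 (p : ℕ) [Fact p.Prime] (G : Type*) [Group G] [Finite G]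
    (hG : IsPGroup p G) (𝒞 : AbelianCover G) (h𝒞 : 𝒞.IsStar p) :
    ∃ (s t : ℕ) (D : Fin t → SubdirectData p G),
      Nonempty (𝒞.FunRing ≃+*
        ((Fin s → Matrix (Fin 2) (Fin 2) (ZMod p)) × ∀ j : Fin t, (D j).ring)) := by
  let ε := (Finite.equivFin (FreeCell p 𝒞)).symm
  -- `Linked` need not be an equivalence relation; `Quot` passes to the one it generates.
  let e := (Finite.equivFin (Quot (Linked (p := p) (𝒞 := 𝒞)))).symm
  obtain ⟨m, σ, hσ⟩ := exists_sigma_equiv_fiber e (Quot.mk (Linked (p := p) (𝒞 := 𝒞)))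
  obtain ⟨n, τ, hτ⟩ := exists_sigma_equiv_fiber e fun E : PointedCell p 𝒞 => Quot.mk _ E.1.1
  have lift : ∀ j (K : FixedSubgroup p 𝒞), Quot.mk _ K = e j → ∃ a, σ ⟨j, a⟩ = K := by
    intro j K hK
    obtain ⟨⟨j', a⟩, rfl⟩ := σ.surjective K
    obtain rfl := e.injective ((hσ j' a).symm.trans hK)
    exact ⟨a, rfl⟩
  have hpos : ∀ j, 0 < m j := by
    intro j
    obtain ⟨K, hK⟩ := Quot.exists_rep (e j)
    obtain ⟨a, -⟩ := lift j K hK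
    exact a.pos
  -- The row index of a pointed cell is the position of its fixed subgroup within the class.
  choose i hi using fun j b => lift j (τ ⟨j, b⟩).1.1 (hτ j b)
  let D : Fin (Nat.card (Quot (Linked (p := p) (𝒞 := 𝒞)))) → SubdirectData p G := fun j =>
    { m := m j
      n := n j
      m_pos := hpos j
      i := i j
      K := ⟨fun a => (σ ⟨j, a⟩).1, fun a b hab => by
        simpa using σ.injective (Subtype.ext hab)⟩ }
  let l : Quot (Linked (p := p) (𝒞 := 𝒞)) → (𝒞.FunRing →+* ZMod p) :=
    Quot.lift (scalar h𝒞) fun K K' h => RingHom.ext (Linked.scalar_eq h𝒞 h)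
  have hl : ∀ j a, scalar h𝒞 (σ ⟨j, a⟩) = l (e j) := fun j a => congrArg l (hσ j a)
  have hlE : ∀ j b, scalar h𝒞 (τ ⟨j, b⟩).1.1 = l (e j) := fun j b =>
    (congrArg (scalar h𝒞) (hi j b)).symm.trans (hl j (i j b))
  let Φ : 𝒞.FunRing →+* ((Fin (Nat.card (FreeCell p 𝒞)) → Matrix (Fin 2) (Fin 2) (ZMod p)) ×
      ∀ j, (D j).ring) :=
    (RingHom.pi fun k => (ε k).coord.matrix (ε k).2.1).prod
      (RingHom.pi fun j => subdirectHom h𝒞 (D j) (fun a => (σ ⟨j, a⟩).2) (l (e j)) (hl j)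
        (fun b => τ ⟨j, b⟩) (hlE j))
  refine ⟨_, _, D, ⟨RingEquiv.ofBijective Φ ⟨fun f g hfg => ?_, ?_⟩⟩⟩
  · have h1 : ∀ k, (ε k).coord.matrix (ε k).2.1 f = (ε k).coord.matrix (ε k).2.1 g :=
      fun k => congrFun (congrArg Prod.fst hfg) k
    have h2 : ∀ j, _ := fun j => congrArg Subtype.val (congrFun (congrArg Prod.snd hfg) j)
    have h3 : ∀ j, _ := fun j => blockMatrix_inj (hpos j)
      (congrArg Subtype.val (congrArg Prod.fst (h2 j)))
    refine FunRing.eq_of_data hG h𝒞 (fun K => ?_) (fun K => ?_) (fun E k => ?_) fun E => ?_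
    · obtain ⟨⟨j, a⟩, rfl⟩ := σ.surjective K
      rw [hl]
      exact (h3 j).1
    · obtain ⟨⟨j, a⟩, rfl⟩ := σ.surjective K
      exact congrArg Subtype.val (congrFun (congrArg Prod.snd (h2 j)) a)
    · obtain ⟨⟨j, b⟩, rfl⟩ := τ.surjective E
      fin_cases k
      · exact congrFun (h3 j).2.1 b
      · exact congrFun (h3 j).2.2 b
    · obtain ⟨k, rfl⟩ := ε.surjective E
      exact h1 k
  · rintro ⟨A, P⟩
    choose lam ν μ hblock htup using fun j => (P j).2
    let d : ActionData p 𝒞 :=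
      { lam := fun K => lam (σ.symm K).1
        lam_eq := fun K K' h => congrArg lam (e.injective (by
          rw [← hσ _ (σ.symm K).2, ← hσ _ (σ.symm K').2]
          simpa using Quot.sound h))
        -- The type of a tuple depends on K, so reindexing along `σ` transports a dependent family.
        tup := Equiv.piCongrLeft
          (fun K : FixedSubgroup p 𝒞 => ∀ M : MaxCyclicAbove K.1.1, ZMod (Nat.card M.1)) σ
          fun q => ((P q.1).1.2 q.2).1
        tup_mem := fun K => by
          obtain ⟨q, rfl⟩ := σ.surjective K
          rw [Equiv.piCongrLeft_apply_apply, Equiv.symm_apply_apply]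
          exact htup q.1 q.2
        ν := fun E => ν (τ.symm E).1 (τ.symm E).2
        μ := fun E => μ (τ.symm E).1 (τ.symm E).2
        A := fun E => A (ε.symm E) }
    obtain ⟨f, hf1, hf2, hf3, hf4⟩ := d.exists_funRing hG h𝒞
    refine ⟨f, Prod.ext (funext fun k => ?_) (funext fun j => Subtype.ext (Prod.ext
      (Subtype.ext ?_) (funext fun a => Subtype.ext ?_)))⟩
    · exact (hf4 (ε k)).trans (congrArg A (ε.symm_apply_apply k))
    · refine Eq.trans ?_ (hblock j).symm
      change blockMatrix (i j) _ _ _ = blockMatrix (i j) _ _ _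
      congr 1
      -- Any member of the class carries the common scalar; the one numbered 0 exists because m is
      -- positive.
      · rw [← hl j ⟨0, hpos j⟩, hf1]
        simp [d]
      · funext b
        rw [hf3]
        exact congrArg (fun q : Σ j, Fin (n j) => ν q.1 q.2) (τ.symm_apply_apply ⟨j, b⟩)
      · funext b
        rw [hf3]
        exact congrArg (fun q : Σ j, Fin (n j) => μ q.1 q.2) (τ.symm_apply_apply ⟨j, b⟩)
    · exact (hf2 (σ ⟨j, a⟩)).trans (Equiv.piCongrLeft_apply_apply _ σ _ ⟨j, a⟩)
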